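/- Theorem. Let $G=(V,E)$ be a finite simple graph with $n$ vertices and maximum degree $\Delta$, and let $\lambda\ge 0$. The hardcore model on $G$ with fugacity $\lambda$ is the probability distribution $\pi$ on labelings $X\in\{0,1\}^V$ with $\pi(X)\propto\lambda^{|\{v:X_v=1\}|}$ if $\{v:X_v=1\}$ is an independent set of $G$, and $\pi(X)=0$ otherwise. Write $b(0)=1$, $b(1)=\lambda$, $A(1,1)=0$ and $A(x,y)=1$ for all other $x,y\in\{0,1\}$. One transition of the distributed Metropolis–Hastings chain with activation probability $p$ from the labeling $X$ is as follows. Independently, every vertex $v$ becomes active with probability $p$, and every active vertex $v$ samples a proposal $\sigma_v\in\{0,1\}$ with probability proportional to $b$. Then, independently, every edge $\{u,v\}$ is accepted with probability $A(X_u,\sigma_v)\,A(\sigma_u,X_v)\,A(\sigma_u,\sigma_v)$, where a factor involving the proposal of an inactive vertex is replaced by $1$. Finally, every active vertex all of whose incident edges are accepted changes its label to $\sigma_v$, and all other labels stay. Let $P_p$ be the transition matrix of this chain. For every real $\alpha<1$ there are $p\in(0,1]$ and $C>0$, depending only on $\alpha$, such that for every such $G$ with $\Delta\ge 2$, every $\lambda$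 with $0\le\lambda\le\frac{\alpha}{\Delta-1}$, every initial labeling $X$ in which the vertices labeled $1$ form an independent set, every $\delta>0$ and every integer $t\ge 0$ with $t\ge C\log\frac{n}{\delta}$, $$\tfrac12\sum_{Y\in\{0,1\}^V}\bigl|P_p^{\,t}(X,Y)-\pi(Y)\bigr|\le\delta .$$ In other words, the chain mixes to within total variation distance $\delta$ in $O(\log\frac n\delta)$ transitions. -/

import Mathlib

open scoped BigOperators

noncomputable section

/-- A pairwise Markov random field with label set `A`: vertex constraints `b v : A → ℝ≥0` and edge
constraints `A_e : A × A → ℝ≥0`. The constraint of an edge `e = {u, v}`, read from `u` to `v`, is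
`edge u v`; reading the same edge from `v` to `u` swaps the two arguments. (`A_e` itself need not be
symmetric. The values of `edge` at pairs that are not edges of the graph play no role.) -/
structure PairwiseMRF (V A : Type*) where
  b : V → A → ℝ
  b_nonneg : ∀ v a, 0 ≤ b v a
  edge : V → V → A → A → ℝ
  edge_nonneg : ∀ u v a c, 0 ≤ edge u v a c
  edge_swap : ∀ u v a c, edge v u c a = edge u v a c

namespace PairwiseMRF

variable {V A : Type*}

/-- `max A_e` for the edge `e = {u, v}`. -/
def edgeMax (M : PairwiseMRF V A) (u v : V) : ℝ :=
  ⨆ z : A × A, M.edge u v z.1 z.2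

/-- The fraction `A_e(x, y) / max A_e`, where the label `none` stands for the missing proposal of an
inactive vertex; the fraction then equals `1`. -/
def edgeRatio (M : PairwiseMRF V A) (u v : V) : Option A → Option A → ℝ
  | some a, some c => M.edge u v a c / M.edgeMax u v
  | _, _ => 1

theorem edgeMax_swap (M : PairwiseMRF V A) (u v : V) : M.edgeMax v u = M.edgeMax u v := by
  unfold edgeMax
  rw [← (Equiv.prodComm A A).iSup_comp]
  simp [M.edge_swap u v]

theorem edgeRatio_swap (M : PairwiseMRF V A) (u v : V) (x y : Option A) :
    M.edgeRatio v u y x = M.edgeRatio u v x y := by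
  cases x <;> cases y <;> simp [edgeRatio, M.edgeMax_swap u v, M.edge_swap u v]

/-- The probability that the edge `e = {u, v}` is accepted, when the current labels are `X` and the
proposals are `s` (`s v = none` if `v` is inactive, `s v = some a` if `v` is active and proposes `a`):
`A_e(X_u, s_v) / max A_e * A_e(s_u, X_v) / max A_e * A_e(s_u, s_v) / max A_e`. -/
def acceptProb (M : PairwiseMRF V A) (X : V → A) (s : V → Option A) : Sym2 V → ℝ :=
  Sym2.lift ⟨fun u v =>
    M.edgeRatio u v (some (X u)) (s v) * M.edgeRatio u v (s u) (some (X v)) *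
      M.edgeRatio u v (s u) (s v), by
    intro u v
    dsimp only
    rw [M.edgeRatio_swap u v (s u) (some (X v)), M.edgeRatio_swap u v (some (X u)) (s v),
      M.edgeRatio_swap u v (s u) (s v)]
    ring⟩

/-- The probability that `v` is inactive (`none`), or is active and proposes `a` (`some a`): `v`
becomes active with probability `p`, and then samples its proposal proportionally to `b v`. -/
def proposalProb [Fintype A] (M : PairwiseMRF V A) (p : ℝ) (v : V) : Option A → ℝ
  | none => 1 - p
  | some a => p * (M.b v a / ∑ c, M.b v c)

/-- The labels after the transition, when `F` is the set of accepted edges: an active vertex takes its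
proposal if every edge incident to it is accepted; all other labels stay. -/
def update [Fintype V] [DecidableEq V] (G : SimpleGraph V) [DecidableRel G.Adj]
    (X : V → A) (s : V → Option A) (F : Finset (Sym2 V)) (v : V) : A :=
  match s v with
  | none => X v
  | some a => if G.incidenceFinset v ⊆ F then a else X v

/-- The transition matrix of the distributed Metropolis-Hastings chain with activation probability
`p`. All vertices draw their proposals independently, then all edges are accepted independently;
`s` runs over the possible proposals and `F` over the possible sets of accepted edges. -/
def metropolis [Fintype V] [DecidableEq V] [Fintype A] [DecidableEq A]
    (G : SimpleGraph V) [DecidableRel G.Adj] (M : PairwiseMRF V A) (p : ℝ) :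
    Matrix (V → A) (V → A) ℝ :=
  Matrix.of fun X Y =>
    ∑ s : V → Option A, ∑ F ∈ G.edgeFinset.powerset,
      if update G X s F = Y then
        (∏ v, M.proposalProb p v (s v)) *
          ((∏ e ∈ F, M.acceptProb X s e) * ∏ e ∈ G.edgeFinset \ F, (1 - M.acceptProb X s e))
      else 0

end PairwiseMRF

/-- The pairwise Markov random field of the hardcore model with fugacity `lam`, with labels `0`
(vacant) and `1` (occupied): `b_v(0) = 1`, `b_v(1) = lam`, and `A_e(x, y) = 0` if `x = y = 1`, and
`A_e(x, y) = 1` otherwise. -/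
def hardcoreMRF (V : Type*) (lam : ℝ) (hlam : 0 ≤ lam) : PairwiseMRF V (Fin 2) where
  b _ a := if a = 1 then lam else 1
  b_nonneg _ a := by
    split_ifs
    · exact hlam
    · exact zero_le_one
  edge _ _ a c := if a = 1 ∧ c = 1 then 0 else 1
  edge_nonneg _ _ a c := by split_ifs <;> norm_num
  edge_swap _ _ a c := by simp only [and_comm]

/-- The labelings in which the vertices labeled `1` form an independent set. -/
def IsIndepLabeling {V : Type*} (G : SimpleGraph V) (X : V → Fin 2) : Prop :=
  G.IsIndepSet {v | X v = 1}

open Classical in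
/-- The unnormalized weight of a labeling in the hardcore model: `lam ^ |I|` if the set `I` of the
vertices labeled `1` is independent, and `0` if it is not. -/
def hardcoreWeight {V : Type*} [Fintype V] (G : SimpleGraph V) (lam : ℝ) (X : V → Fin 2) : ℝ :=
  if IsIndepLabeling G X then lam ^ (Finset.univ.filter fun v => X v = 1).card else 0

/-- The hardcore distribution with fugacity `lam`, as a probability vector on the labelings. -/
def hardcoreDist {V : Type*} [Fintype V] [DecidableEq V] (G : SimpleGraph V) (lam : ℝ)
    (X : V → Fin 2) : ℝ :=
  hardcoreWeight G lam X / ∑ Y : V → Fin 2, hardcoreWeight G lam Y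

/-- The total variation distance of two probability vectors on a finite set. -/
def tvDistance {S : Type*} [Fintype S] (μ ν : S → ℝ) : ℝ :=
  (1 / 2) * ∑ x, |μ x - ν x|

end

/-! Every acceptance probability of the hardcore model is 0 or 1, so a transition is a deterministic
map `step G · s` of the labeling once the random proposals `s` are drawn. This makes both halves of
the proof elementary.

Stationarity: on pairs of an independent labeling and a proposal vector, exchanging old and proposed
labels at the unblocked active vertices is an involution that preserves weight times proposal
probability. Summing over all pairs shows that the hardcore distribution is invariant.

Contraction: run two copies with the same proposals. If they differ only in that `v` is occupied in
one, `v` can still disagree only if it is inactive or some neighbor proposes 1, and a neighbor can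
disagree only if it proposes 1. With `r = 2α/(1+α) < 1` bounding `Δλ/(1+λ)`, the expected distance
is at most `1 - p + (1+p)pr`, which is below 1 for small `p`. Path coupling along deletions of
occupied vertices extends this rate to all independent pairs. By duality the chain contracts
Lipschitz constants, and testing against a sign function bounds total variation by `c ^ t * n`. -/

namespace Hardcore

/-! ### A transition as a deterministic map of the proposals -/

variable {V : Type*}

/-- The edge `{u, v}` is rejected by the hardcore constraints. -/
def EdgeRejected (X : V → Fin 2) (s : V → Option (Fin 2)) (u v : V) : Prop :=
  (X u = 1 ∧ s v = some 1) ∨ (s u = some 1 ∧ X v = 1) ∨ (s u = some 1 ∧ s v = some 1)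

theorem EdgeRejected.symm {X : V → Fin 2} {s : V → Option (Fin 2)} {u v : V}
    (h : EdgeRejected X s u v) : EdgeRejected X s v u := by
  unfold EdgeRejected at *
  tauto

/-- Some edge incident to `v` is rejected. -/
def Blocked (G : SimpleGraph V) (X : V → Fin 2) (s : V → Option (Fin 2)) (v : V) : Prop :=
  ∃ u, G.Adj v u ∧ EdgeRejected X s v u

open Classical in
/-- The labeling after a transition from `X` with proposals `s`. -/
noncomputable def step (G : SimpleGraph V) (X : V → Fin 2) (s : V → Option (Fin 2)) (v : V) :
    Fin 2 :=
  if Blocked G X s v then X v else (s v).getD (X v)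

open Classical in
/-- The proposals which lead from `step G X s` back to `X`. -/
noncomputable def reverse (G : SimpleGraph V) (X : V → Fin 2) (s : V → Option (Fin 2)) (v : V) :
    Option (Fin 2) :=
  if Blocked G X s v then s v else (s v).map fun _ => X v

/-- The vertex weight of the hardcore model. -/
def labelWeight (lam : ℝ) (a : Fin 2) : ℝ := if a = 1 then lam else 1

/-- The probability of a proposal, or of inactivity, at any vertex. -/
noncomputable def proposal (lam p : ℝ) : Option (Fin 2) → ℝ
  | none => 1 - p
  | some a => p * (labelWeight lam a / (1 + lam))

theorem proposalProb_eq (lam : ℝ) (hlam : 0 ≤ lam) (p : ℝ) (v : V) (x : Option (Fin 2)) :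
    (hardcoreMRF V lam hlam).proposalProb p v x = proposal lam p x := by
  cases x <;> simp [PairwiseMRF.proposalProb, proposal, hardcoreMRF, labelWeight]

theorem edgeMax_eq (lam : ℝ) (hlam : 0 ≤ lam) (u v : V) :
    (hardcoreMRF V lam hlam).edgeMax u v = 1 := by
  unfold PairwiseMRF.edgeMax
  apply le_antisymm
  · apply ciSup_le
    intro z
    simp only [hardcoreMRF]
    split_ifs <;> norm_num
  · refine le_ciSup_of_le (Set.finite_range _).bddAbove (0, 0) ?_
    simp [hardcoreMRF]

open Classical in
theorem acceptProb_eq (lam : ℝ) (hlam : 0 ≤ lam) (X : V → Fin 2) (s : V → Option (Fin 2))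
    (u v : V) :
    (hardcoreMRF V lam hlam).acceptProb X s s(u, v) = if EdgeRejected X s u v then 0 else 1 := by
  simp only [PairwiseMRF.acceptProb, Sym2.lift_mk]
  unfold EdgeRejected
  cases hu : s u <;> cases hv : s v <;>
    (simp only [PairwiseMRF.edgeRatio, edgeMax_eq]; simp [hardcoreMRF]) <;> grind

theorem isIndepLabeling_iff {G : SimpleGraph V} {X : V → Fin 2} :
    IsIndepLabeling G X ↔ ∀ u v, G.Adj u v → ¬ (X u = 1 ∧ X v = 1) := by
  constructor
  · rintro h u v huv ⟨hu, hv⟩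
    exact h hu hv huv.ne huv
  · intro h u hu v hv _ huv
    exact h u v huv ⟨hu, hv⟩

/-! ### Independence is preserved, and transitions can be reversed -/

theorem isIndepLabeling_step {G : SimpleGraph V} {X : V → Fin 2} (hX : IsIndepLabeling G X)
    (s : V → Option (Fin 2)) : IsIndepLabeling G (step G X s) := by
  rw [isIndepLabeling_iff] at *
  intro u v huv
  have h := hX u v huv
  have hu : ¬ Blocked G X s u → ¬ EdgeRejected X s u v := fun hb hr => hb ⟨v, huv, hr⟩
  have hv : ¬ Blocked G X s v → ¬ EdgeRejected X s u v := fun hb hr => hb ⟨u, huv.symm, hr.symm⟩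
  unfold step
  unfold EdgeRejected at *
  cases hsu : s u <;> cases hsv : s v <;> split_ifs <;> simp_all

/-- A rejected edge blocks both endpoints, so nothing changes there. Across an accepted edge no pair
of a current or proposed label at `u` with one at `v` is `(1, 1)`: three pairs are excluded by
acceptance and the fourth by independence of `X`. This condition on all four pairs survives
exchanging the labels at either endpoint. -/
theorem edgeRejected_reverse {G : SimpleGraph V} {X : V → Fin 2} (hX : IsIndepLabeling G X)
    (s : V → Option (Fin 2)) {u v : V} (huv : G.Adj u v) :
    EdgeRejected (step G X s) (reverse G X s) u v ↔ EdgeRejected X s u v := by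
  have h := isIndepLabeling_iff.1 hX u v huv
  have hu : ¬ Blocked G X s u → ¬ EdgeRejected X s u v := fun hb hr => hb ⟨v, huv, hr⟩
  have hv : ¬ Blocked G X s v → ¬ EdgeRejected X s u v := fun hb hr => hb ⟨u, huv.symm, hr.symm⟩
  by_cases hbu : Blocked G X s u <;> by_cases hbv : Blocked G X s v <;>
    cases hsu : s u <;> cases hsv : s v <;>
    simp_all [EdgeRejected, step, reverse] <;> grind

theorem blocked_reverse {G : SimpleGraph V} {X : V → Fin 2} (hX : IsIndepLabeling G X)
    (s : V → Option (Fin 2)) (v : V) :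
    Blocked G (step G X s) (reverse G X s) v ↔ Blocked G X s v := by
  unfold Blocked
  exact exists_congr fun u => and_congr_right fun h => edgeRejected_reverse hX s h

theorem step_reverse {G : SimpleGraph V} {X : V → Fin 2} (hX : IsIndepLabeling G X)
    (s : V → Option (Fin 2)) : step G (step G X s) (reverse G X s) = X := by
  funext v
  rw [step, blocked_reverse hX]
  unfold step reverse
  split_ifs <;> cases s v <;> rfl

theorem reverse_reverse {G : SimpleGraph V} {X : V → Fin 2} (hX : IsIndepLabeling G X)
    (s : V → Option (Fin 2)) : reverse G (step G X s) (reverse G X s) = s := by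
  funext v
  rw [reverse, blocked_reverse hX]
  unfold step reverse
  split_ifs <;> cases s v <;> rfl

theorem proposal_nonneg {lam p : ℝ} (hlam : 0 ≤ lam) (hp0 : 0 ≤ p) (hp1 : p ≤ 1)
    (x : Option (Fin 2)) : 0 ≤ proposal lam p x := by
  cases x with
  | none => simpa [proposal] using hp1
  | some a =>
    have : 0 ≤ labelWeight lam a := by unfold labelWeight; split_ifs <;> linarith
    simp only [proposal]
    positivity

theorem sum_proposal {lam : ℝ} (hlam : 0 ≤ lam) (p : ℝ) : ∑ x, proposal lam p x = 1 := by
  have : (1 + lam) ≠ 0 := by positivity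
  simp [Fintype.sum_option, proposal, labelWeight]
  field_simp
  ring

theorem isIndepLabeling_update_zero [DecidableEq V] {G : SimpleGraph V}
    {X : V → Fin 2} (hX : IsIndepLabeling G X) (v : V) : IsIndepLabeling G (Function.update X v 0) := by
  rw [isIndepLabeling_iff] at *
  intro a c hac
  have := hX a c hac
  simp only [Function.update_apply]
  split_ifs <;> simp_all

variable [Fintype V]

theorem hardcoreWeight_eq_prod {G : SimpleGraph V} {X : V → Fin 2} (hX : IsIndepLabeling G X)
    (lam : ℝ) : hardcoreWeight G lam X = ∏ v, labelWeight lam (X v) := by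
  classical
  rw [hardcoreWeight, if_pos hX]
  simp only [labelWeight]
  rw [Finset.prod_ite, Finset.prod_const, Finset.prod_const_one, mul_one]

/-- Detailed balance, vertex by vertex: where the label moves, the old and the proposed label trade
their factors `labelWeight`. -/
theorem weight_mul_proposal_reverse {G : SimpleGraph V} {X : V → Fin 2}
    (hX : IsIndepLabeling G X) (lam p : ℝ) (s : V → Option (Fin 2)) :
    hardcoreWeight G lam (step G X s) * ∏ v, proposal lam p (reverse G X s v) =
      hardcoreWeight G lam X * ∏ v, proposal lam p (s v) := by
  rw [hardcoreWeight_eq_prod hX, hardcoreWeight_eq_prod (isIndepLabeling_step hX s),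
    ← Finset.prod_mul_distrib, ← Finset.prod_mul_distrib]
  refine Finset.prod_congr rfl fun v _ => ?_
  unfold step reverse
  split_ifs
  · rfl
  · cases s v with
    | none => rfl
    | some a => simp only [Option.getD_some, Option.map_some, proposal]; ring

theorem hardcoreWeight_nonneg (G : SimpleGraph V) {lam : ℝ} (hlam : 0 ≤ lam) (X : V → Fin 2) :
    0 ≤ hardcoreWeight G lam X := by
  unfold hardcoreWeight
  split_ifs <;> positivity

variable [DecidableEq V]

/-! ### The transition matrix as an average over proposals -/

theorem update_eq_step (lam : ℝ) (hlam : 0 ≤ lam) (G : SimpleGraph V) [DecidableRel G.Adj]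
    (X : V → Fin 2) (s : V → Option (Fin 2)) :
    PairwiseMRF.update G X s
      (G.edgeFinset.filter fun e => (hardcoreMRF V lam hlam).acceptProb X s e = 1) =
      step G X s := by
  funext v
  have key : G.incidenceFinset v ⊆
      (G.edgeFinset.filter fun e => (hardcoreMRF V lam hlam).acceptProb X s e = 1) ↔
      ¬ Blocked G X s v := by
    constructor
    · rintro h ⟨u, hu, hr⟩
      have := h ((G.mem_incidenceFinset v s(v, u)).2 ((G.mem_incidence_iff_neighbor).2 hu))
      rw [Finset.mem_filter, acceptProb_eq, if_pos hr] at this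
      exact zero_ne_one this.2
    · intro h e he
      rw [SimpleGraph.mem_incidenceFinset] at he
      obtain ⟨he, hv⟩ := he
      obtain ⟨u, rfl⟩ := hv
      rw [Finset.mem_filter, acceptProb_eq, if_neg fun hr => h ⟨u, he, hr⟩]
      exact ⟨SimpleGraph.mem_edgeFinset.2 he, rfl⟩
  unfold PairwiseMRF.update step
  cases hs : s v with
  | none => simp
  | some a => by_cases hb : Blocked G X s v <;> simp [key, hb]

theorem metropolis_apply (lam : ℝ) (hlam : 0 ≤ lam) (G : SimpleGraph V) [DecidableRel G.Adj]
    (p : ℝ) (X Y : V → Fin 2) :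
    (hardcoreMRF V lam hlam).metropolis G p X Y =
      ∑ s : V → Option (Fin 2), if step G X s = Y then ∏ v, proposal lam p (s v) else 0 := by
  classical
  simp only [PairwiseMRF.metropolis, Matrix.of_apply, proposalProb_eq]
  refine Finset.sum_congr rfl fun s _ => ?_
  have h01 : ∀ e, (hardcoreMRF V lam hlam).acceptProb X s e = 0 ∨
      (hardcoreMRF V lam hlam).acceptProb X s e = 1 := by
    intro e
    induction e with
    | _ u v => rw [acceptProb_eq]; split_ifs <;> simp
  -- Only the set of edges with acceptance probability 1 contributes; any other `F` picks up a zero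
  -- factor.
  rw [Finset.sum_eq_single
    (G.edgeFinset.filter fun e => (hardcoreMRF V lam hlam).acceptProb X s e = 1)]
  · rw [update_eq_step, Finset.prod_eq_one (s := Finset.filter _ _),
      Finset.prod_eq_one (s := _ \ _), mul_one, mul_one]
    · intro e he
      rw [Finset.mem_sdiff, Finset.mem_filter] at he
      rcases h01 e with h | h
      · rw [h, sub_zero]
      · exact absurd ⟨he.1, h⟩ he.2
    · intro e he
      exact (Finset.mem_filter.1 he).2
  · intro F hF hne
    rw [ite_eq_right_iff]
    intro _
    apply mul_eq_zero_of_right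
    by_contra h
    obtain ⟨h1, h2⟩ := mul_ne_zero_iff.1 h
    rw [Finset.prod_ne_zero_iff] at h1 h2
    apply hne
    ext e
    rw [Finset.mem_filter]
    constructor
    · intro he
      exact ⟨Finset.mem_powerset.1 hF he, (h01 e).resolve_left (h1 e he)⟩
    · rintro ⟨he, h⟩
      by_contra hn
      exact h2 e (Finset.mem_sdiff.2 ⟨he, hn⟩) (by rw [h, sub_self])
  · intro h
    exact absurd (Finset.mem_powerset.2 (Finset.filter_subset _ _)) h

theorem metropolis_mulVec (lam : ℝ) (hlam : 0 ≤ lam) (G : SimpleGraph V) [DecidableRel G.Adj]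
    (p : ℝ) (g : (V → Fin 2) → ℝ) (X : V → Fin 2) :
    ((hardcoreMRF V lam hlam).metropolis G p).mulVec g X =
      ∑ s : V → Option (Fin 2), (∏ v, proposal lam p (s v)) * g (step G X s) := by
  simp only [Matrix.mulVec, dotProduct, metropolis_apply, Finset.sum_mul, ite_mul, zero_mul]
  rw [Finset.sum_comm]
  simp

/-! ### Stationarity -/

theorem sum_weight_mul_metropolis_mulVec (lam : ℝ) (hlam : 0 ≤ lam) (G : SimpleGraph V)
    [DecidableRel G.Adj] (p : ℝ) (hp : ∑ x, proposal lam p x = 1) (g : (V → Fin 2) → ℝ) :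
    ∑ X, hardcoreWeight G lam X * ((hardcoreMRF V lam hlam).metropolis G p).mulVec g X =
      ∑ X, hardcoreWeight G lam X * g X := by
  classical
  have hw : ∑ s : V → Option (Fin 2), ∏ v, proposal lam p (s v) = 1 := by
    rw [← Fintype.prod_sum (fun _ : V => proposal lam p)]
    simp [hp]
  -- The involution needs independent labelings; all others have weight zero.
  have hrest : ∀ f : (V → Fin 2) → ℝ, ∑ X, hardcoreWeight G lam X * f X =
      ∑ X with IsIndepLabeling G X, hardcoreWeight G lam X * f X := by
    intro f
    rw [Finset.sum_filter]
    refine Finset.sum_congr rfl fun X _ => ?_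
    split_ifs with h
    · rfl
    · rw [hardcoreWeight, if_neg h, zero_mul]
  have hone : ∀ X, hardcoreWeight G lam X * g X =
      ∑ s : V → Option (Fin 2), hardcoreWeight G lam X * (∏ v, proposal lam p (s v)) * g X := by
    intro X
    rw [← Finset.sum_mul, ← Finset.mul_sum, hw, mul_one]
  rw [hrest, hrest, Finset.sum_congr rfl fun X _ => hone X]
  simp only [metropolis_mulVec, Finset.mul_sum]
  rw [← Finset.sum_product', ← Finset.sum_product']
  refine Finset.sum_nbij' (fun z => (step G z.1 z.2, reverse G z.1 z.2))
    (fun z => (step G z.1 z.2, reverse G z.1 z.2)) ?_ ?_ ?_ ?_ ?_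
  · rintro ⟨X, s⟩ h
    simp only [Finset.mem_product, Finset.mem_filter, Finset.mem_univ, true_and, and_true] at h ⊢
    exact isIndepLabeling_step h s
  · rintro ⟨X, s⟩ h
    simp only [Finset.mem_product, Finset.mem_filter, Finset.mem_univ, true_and, and_true] at h ⊢
    exact isIndepLabeling_step h s
  · rintro ⟨X, s⟩ h
    simp only [Finset.mem_product, Finset.mem_filter, Finset.mem_univ, true_and, and_true] at h ⊢
    rw [step_reverse h, reverse_reverse h]
  · rintro ⟨X, s⟩ h
    simp only [Finset.mem_product, Finset.mem_filter, Finset.mem_univ, true_and, and_true] at h ⊢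
    rw [step_reverse h, reverse_reverse h]
  · rintro ⟨X, s⟩ h
    simp only [Finset.mem_product, Finset.mem_filter, Finset.mem_univ, true_and, and_true] at h ⊢
    rw [weight_mul_proposal_reverse h, mul_assoc]

theorem sum_weight_mul_metropolis_pow_mulVec (lam : ℝ) (hlam : 0 ≤ lam) (G : SimpleGraph V)
    [DecidableRel G.Adj] (p : ℝ) (hp : ∑ x, proposal lam p x = 1) (g : (V → Fin 2) → ℝ) (t : ℕ) :
    ∑ X, hardcoreWeight G lam X * ((hardcoreMRF V lam hlam).metropolis G p ^ t).mulVec g X =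
      ∑ X, hardcoreWeight G lam X * g X := by
  induction t with
  | zero => simp
  | succ t ih =>
    rw [← ih, pow_succ', ← Matrix.mulVec_mulVec, sum_weight_mul_metropolis_mulVec _ _ _ _ hp]

/-! ### One-step contraction of the coupled chains -/

theorem sum_prod_mul_single {S : Type*} [Fintype S] {q : S → ℝ} (hq : ∑ x, q x = 1) (v : V)
    (f : S → ℝ) : ∑ s : V → S, (∏ w, q (s w)) * f (s v) = ∑ x, q x * f x := by
  have h : ∀ s : V → S, (∏ w, q (s w)) * f (s v) =
      ∏ w, (q (s w) * if w = v then f (s w) else 1) := by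
    intro s
    rw [Finset.prod_mul_distrib]
    simp
  rw [Finset.sum_congr rfl fun s _ => h s,
    ← Fintype.prod_sum (fun w x => q x * if w = v then f x else 1), Finset.prod_eq_single v]
  · simp
  · intro w _ hw
    simp [hw, hq]
  · simp

theorem sum_prod_mul_pair {S : Type*} [Fintype S] {q : S → ℝ} (hq : ∑ x, q x = 1) {u v : V}
    (huv : u ≠ v) (f g : S → ℝ) : ∑ s : V → S, (∏ w, q (s w)) * (f (s u) * g (s v)) =
      (∑ x, q x * f x) * ∑ x, q x * g x := by
  have h : ∀ s : V → S, (∏ w, q (s w)) * (f (s u) * g (s v)) =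
      ∏ w, (q (s w) * ((if w = u then f (s w) else 1) * if w = v then g (s w) else 1)) := by
    intro s
    rw [Finset.prod_mul_distrib, Finset.prod_mul_distrib]
    simp
  rw [Finset.sum_congr rfl fun s _ => h s, ← Fintype.prod_sum
    (fun w x => q x * ((if w = u then f x else 1) * if w = v then g x else 1)),
    Finset.prod_eq_mul u v huv]
  · simp [huv, huv.symm]
  · intro w _ hw
    simp [hw.1, hw.2, hq]
  · simp
  · simp

/-- The first term and the products pay for a disagreement at `v`, inactive or active respectively;
the last indicator pays for one at the neighbor `u`. Neighbors of the occupied `v` are vacant in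
both labelings. -/
theorem hammingDist_step_update_le {G : SimpleGraph V} [DecidableRel G.Adj] {X : V → Fin 2}
    (hX : IsIndepLabeling G X) {v : V} (hv : X v = 1) (s : V → Option (Fin 2)) :
    (hammingDist (step G X s) (step G (Function.update X v 0) s) : ℝ) ≤
      (if s v = none then 1 else 0) +
        ∑ u ∈ G.neighborFinset v, ((if s v = none then 0 else 1) * (if s u = some 1 then 1 else 0) +
          if s u = some 1 then 1 else 0) := by
  classical
  set Y := Function.update X v 0 with hY
  have hYv : Y v = 0 := by simp [hY]
  have hYu : ∀ u, u ≠ v → Y u = X u := fun u hu => by simp [hY, hu]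
  have hN : ∀ u, G.Adj v u → X u = 0 := by
    intro u hu
    have := isIndepLabeling_iff.1 hX v u hu
    have h2 : ¬ X u = 1 := fun h => this ⟨hv, h⟩
    omega
  have hdist : (hammingDist (step G X s) (step G Y s) : ℝ) =
      ∑ u, if step G X s u ≠ step G Y s u then (1 : ℝ) else 0 := by
    rw [hammingDist, Finset.natCast_card_filter]
  -- Blocking of `u` depends on labels only at `u` and its neighbors.
  have hfar : ∀ u, u ≠ v → ¬ G.Adj v u → step G X s u = step G Y s u := by
    intro u hu hadj
    have : Blocked G X s u ↔ Blocked G Y s u := by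
      unfold Blocked EdgeRejected
      refine exists_congr fun w => and_congr_right fun hw => ?_
      have hwv : w ≠ v := by rintro rfl; exact hadj hw.symm
      rw [hYu u hu, hYu w hwv]
    simp only [step, this, hYu u hu]
  -- A vacant vertex that does not propose 1 stays vacant, blocked or not.
  have hnear : ∀ u, G.Adj v u → step G X s u ≠ step G Y s u → s u = some 1 := by
    intro u hu hne
    by_contra hs
    apply hne
    have h1 := hN u hu
    have h2 := hYu u hu.ne'
    simp only [step, h1, h2]
    rcases hsu : s u with _ | a
    · simp
    · have : a = 0 := by
        have : a ≠ 1 := by rintro rfl; exact hs hsu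
        omega
      simp [this]
  -- If no neighbor proposes 1, then `v` is unblocked in both copies, and both take its proposal.
  have hself : step G X s v ≠ step G Y s v → s v ≠ none → ∃ u, G.Adj v u ∧ s u = some 1 := by
    intro hne hs
    by_contra hcon
    push Not at hcon
    apply hne
    have hbX : ¬ Blocked G X s v := by
      rintro ⟨u, hu, h⟩
      have h1 := hN u hu
      have h2 := hcon u hu
      simp [EdgeRejected, h1, h2] at h
    have hbY : ¬ Blocked G Y s v := by
      rintro ⟨u, hu, h⟩
      have h1 := hN u hu
      have h2 := hcon u hu
      have h3 := hYu u hu.ne'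
      simp [EdgeRejected, h1, h2, h3] at h
    obtain ⟨a, ha⟩ := Option.ne_none_iff_exists'.1 hs
    simp [step, hbX, hbY, ha]
  rw [hdist, Finset.sum_add_distrib, ← add_assoc,
    ← Finset.add_sum_erase _ _ (Finset.mem_univ v)]
  apply add_le_add
  · have hnn : ∀ u ∈ G.neighborFinset v,
        (0 : ℝ) ≤ (if s v = none then 0 else 1) * (if s u = some 1 then 1 else 0) := by
      intro u _
      split_ifs <;> norm_num
    by_cases hne : step G X s v ≠ step G Y s v
    · rw [if_pos hne]
      by_cases hs : s v = none
      · rw [if_pos hs]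
        linarith [Finset.sum_nonneg hnn]
      · obtain ⟨u, hu, hsu⟩ := hself hne hs
        have := Finset.single_le_sum hnn ((G.mem_neighborFinset v u).2 hu)
        simp only [hs, hsu, if_true, if_false] at this ⊢
        linarith
    · rw [if_neg hne]
      exact add_nonneg (by split_ifs <;> norm_num) (Finset.sum_nonneg hnn)
  · have hsub : G.neighborFinset v ⊆ Finset.univ.erase v := by
      intro u hu
      rw [SimpleGraph.mem_neighborFinset] at hu
      exact Finset.mem_erase.2 ⟨hu.ne', Finset.mem_univ u⟩
    rw [← Finset.sum_subset hsub]
    · refine Finset.sum_le_sum fun u hu => ?_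
      rw [SimpleGraph.mem_neighborFinset] at hu
      by_cases hne : step G X s u ≠ step G Y s u
      · rw [if_pos hne, if_pos (hnear u hu hne)]
      · rw [if_neg hne]
        split_ifs <;> norm_num
    · intro u hu hn
      rw [SimpleGraph.mem_neighborFinset] at hn
      rw [if_neg (not_not.2 (hfar u (Finset.ne_of_mem_erase hu) hn))]

/-- The expected Hamming distance after one transition with the same proposals. -/
noncomputable def coupledDist (G : SimpleGraph V) (lam p : ℝ) (X Y : V → Fin 2) : ℝ :=
  ∑ s : V → Option (Fin 2),
    (∏ v, proposal lam p (s v)) * (hammingDist (step G X s) (step G Y s) : ℝ)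

theorem coupledDist_symm (G : SimpleGraph V) (lam p : ℝ) (X Y : V → Fin 2) :
    coupledDist G lam p X Y = coupledDist G lam p Y X := by
  simp only [coupledDist, hammingDist_comm]

theorem coupledDist_triangle (G : SimpleGraph V) {lam p : ℝ} (hlam : 0 ≤ lam) (hp0 : 0 ≤ p)
    (hp1 : p ≤ 1) (X Y Z : V → Fin 2) :
    coupledDist G lam p X Z ≤ coupledDist G lam p X Y + coupledDist G lam p Y Z := by
  unfold coupledDist
  rw [← Finset.sum_add_distrib]
  refine Finset.sum_le_sum fun s _ => ?_
  rw [← mul_add]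
  refine mul_le_mul_of_nonneg_left ?_
    (Finset.prod_nonneg fun v _ => proposal_nonneg hlam hp0 hp1 _)
  exact_mod_cast hammingDist_triangle _ _ _

/-- The expectation of the preceding pointwise bound. Independence of the proposals at `v` and at a
neighbor gives the factor `p` in `1 + p`. -/
theorem coupledDist_update_le {G : SimpleGraph V} [DecidableRel G.Adj] {lam p : ℝ}
    (hlam : 0 ≤ lam) (hp0 : 0 ≤ p) (hp1 : p ≤ 1) {X : V → Fin 2} (hX : IsIndepLabeling G X)
    {v : V} (hv : X v = 1) :
    coupledDist G lam p X (Function.update X v 0) ≤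
      1 - p + (1 + p) * (G.maxDegree * (p * (lam / (1 + lam)))) := by
  have hq := sum_proposal hlam p
  have hb : 0 ≤ p * (lam / (1 + lam)) := by positivity
  have hnone : ∑ x, proposal lam p x * (if x = none then 1 else 0) = 1 - p := by
    simp [proposal]
  have hact : ∑ x, proposal lam p x * (if x = none then 0 else 1) = p := by
    have : ∀ x, proposal lam p x * (if x = none then (0 : ℝ) else 1) =
        proposal lam p x - proposal lam p x * (if x = none then 1 else 0) := by
      intro x
      split_ifs <;> ring
    rw [Finset.sum_congr rfl fun x _ => this x, Finset.sum_sub_distrib, hq, hnone]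
    ring
  have hocc : ∑ x, proposal lam p x * (if x = some 1 then 1 else 0) = p * (lam / (1 + lam)) := by
    simp [proposal, labelWeight]
  calc coupledDist G lam p X (Function.update X v 0)
      ≤ ∑ s : V → Option (Fin 2), (∏ w, proposal lam p (s w)) *
        ((if s v = none then 1 else 0) + ∑ u ∈ G.neighborFinset v,
          ((if s v = none then 0 else 1) * (if s u = some 1 then 1 else 0) +
            if s u = some 1 then 1 else 0)) := by
        refine Finset.sum_le_sum fun s _ => mul_le_mul_of_nonneg_left
          (hammingDist_step_update_le hX hv s)
          (Finset.prod_nonneg fun w _ => proposal_nonneg hlam hp0 hp1 _)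
    _ = 1 - p + ∑ u ∈ G.neighborFinset v, (1 + p) * (p * (lam / (1 + lam))) := by
        simp only [mul_add, Finset.sum_add_distrib, Finset.mul_sum]
        rw [sum_prod_mul_single hq v (fun x => if x = none then (1 : ℝ) else 0), hnone,
          Finset.sum_comm, Finset.sum_comm (s := Finset.univ) (t := G.neighborFinset v),
          ← Finset.sum_add_distrib]
        congr 1
        refine Finset.sum_congr rfl fun u hu => ?_
        rw [SimpleGraph.mem_neighborFinset] at hu
        rw [sum_prod_mul_pair hq hu.ne (fun x => if x = none then (0 : ℝ) else 1)
            (fun x => if x = some 1 then (1 : ℝ) else 0),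
          sum_prod_mul_single hq u (fun x => if x = some 1 then (1 : ℝ) else 0), hact, hocc]
        ring
    _ = 1 - p + (1 + p) * (G.degree v * (p * (lam / (1 + lam)))) := by
        rw [Finset.sum_const, SimpleGraph.card_neighborFinset_eq_degree, nsmul_eq_mul]
        ring
    _ ≤ _ := by
        have : (G.degree v : ℝ) ≤ G.maxDegree := by exact_mod_cast G.degree_le_maxDegree v
        gcongr

/-- Path coupling. At a disagreement exactly one labeling is occupied; vacating that vertex shortens
the distance by one and, unlike adding a vertex, never leaves the independent labelings. -/
theorem coupledDist_le {G : SimpleGraph V} {lam p c : ℝ} (hlam : 0 ≤ lam) (hp0 : 0 ≤ p)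
    (hp1 : p ≤ 1) (hc : ∀ X : V → Fin 2, IsIndepLabeling G X → ∀ v, X v = 1 →
      coupledDist G lam p X (Function.update X v 0) ≤ c) (k : ℕ) :
    ∀ X Y : V → Fin 2, IsIndepLabeling G X → IsIndepLabeling G Y → hammingDist X Y = k →
      coupledDist G lam p X Y ≤ c * k := by
  have hremove : ∀ (X Y : V → Fin 2) (v : V) (k : ℕ), X v = 1 → Y v = 0 →
      hammingDist X Y = k + 1 → hammingDist (Function.update X v 0) Y = k := by
    intro X Y v k hXv hYv h
    have : (Finset.univ.filter fun u => Function.update X v 0 u ≠ Y u) =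
        (Finset.univ.filter fun u => X u ≠ Y u).erase v := by
      ext u
      by_cases hu : u = v
      · subst hu; simp [hYv]
      · simp [hu]
    unfold hammingDist at h ⊢
    rw [this, Finset.card_erase_of_mem (by simp [hXv, hYv]), h]
    rfl
  induction k with
  | zero =>
    intro X Y _ _ h
    rw [hammingDist_eq_zero] at h
    subst h
    simp [coupledDist]
  | succ k ih =>
    have hstep : ∀ (X Y : V → Fin 2) (v : V), IsIndepLabeling G X → IsIndepLabeling G Y →
        X v = 1 → Y v = 0 → hammingDist X Y = k + 1 → coupledDist G lam p X Y ≤ c * (k + 1) := by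
      intro X Y v hX hY hXv hYv h
      have h1 := hc X hX v hXv
      have h2 := ih _ Y (isIndepLabeling_update_zero hX v) hY (hremove X Y v k hXv hYv h)
      have h3 := coupledDist_triangle G hlam hp0 hp1 X (Function.update X v 0) Y
      linarith
    intro X Y hX hY h
    push_cast
    have hne : X ≠ Y := by
      rintro rfl
      simp at h
    obtain ⟨v, hv⟩ := Function.ne_iff.1 hne
    rcases (by omega : (X v = 1 ∧ Y v = 0) ∨ (X v = 0 ∧ Y v = 1)) with ⟨h1, h2⟩ | ⟨h1, h2⟩
    · exact hstep X Y v hX hY h1 h2 h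
    · rw [coupledDist_symm]
      exact hstep Y X v hY hX h2 h1 (by rw [hammingDist_comm, h])

/-! ### From contraction to total variation distance -/

/-- `g` is `L`-Lipschitz for the Hamming distance on the independent labelings. -/
def IsLipschitz (G : SimpleGraph V) (L : ℝ) (g : (V → Fin 2) → ℝ) : Prop :=
  ∀ X Y, IsIndepLabeling G X → IsIndepLabeling G Y → |g X - g Y| ≤ L * hammingDist X Y

/-- The dual form of contraction: the coupling writes the difference of two averages as one average
of differences. -/
theorem IsLipschitz.metropolis_mulVec {G : SimpleGraph V} [DecidableRel G.Adj] {lam p c L : ℝ}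
    (hlam : 0 ≤ lam) (hp0 : 0 ≤ p) (hp1 : p ≤ 1) (hL : 0 ≤ L)
    (hc : ∀ X Y : V → Fin 2, IsIndepLabeling G X → IsIndepLabeling G Y →
      coupledDist G lam p X Y ≤ c * hammingDist X Y) {g : (V → Fin 2) → ℝ}
    (hg : IsLipschitz G L g) :
    IsLipschitz G (c * L) (((hardcoreMRF V lam hlam).metropolis G p).mulVec g) := by
  intro X Y hX hY
  rw [Hardcore.metropolis_mulVec, Hardcore.metropolis_mulVec, ← Finset.sum_sub_distrib]
  calc |∑ s : V → Option (Fin 2), ((∏ v, proposal lam p (s v)) * g (step G X s) -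
        (∏ v, proposal lam p (s v)) * g (step G Y s))|
      ≤ ∑ s : V → Option (Fin 2), |(∏ v, proposal lam p (s v)) * g (step G X s) -
        (∏ v, proposal lam p (s v)) * g (step G Y s)| := Finset.abs_sum_le_sum_abs _ _
    _ ≤ ∑ s : V → Option (Fin 2), (∏ v, proposal lam p (s v)) *
        (L * hammingDist (step G X s) (step G Y s)) := by
        refine Finset.sum_le_sum fun s _ => ?_
        have hw : 0 ≤ ∏ v, proposal lam p (s v) :=
          Finset.prod_nonneg fun v _ => proposal_nonneg hlam hp0 hp1 _
        rw [← mul_sub, abs_mul, abs_of_nonneg hw]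
        exact mul_le_mul_of_nonneg_left
          (hg _ _ (isIndepLabeling_step hX s) (isIndepLabeling_step hY s)) hw
    _ = L * coupledDist G lam p X Y := by
        rw [coupledDist, Finset.mul_sum]
        exact Finset.sum_congr rfl fun s _ => by ring
    _ ≤ L * (c * hammingDist X Y) := mul_le_mul_of_nonneg_left (hc X Y hX hY) hL
    _ = c * L * hammingDist X Y := by ring

theorem IsLipschitz.metropolis_pow_mulVec {G : SimpleGraph V} [DecidableRel G.Adj]
    {lam p c : ℝ} (hlam : 0 ≤ lam) (hp0 : 0 ≤ p) (hp1 : p ≤ 1) (hc0 : 0 ≤ c)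
    (hc : ∀ X Y : V → Fin 2, IsIndepLabeling G X → IsIndepLabeling G Y →
      coupledDist G lam p X Y ≤ c * hammingDist X Y) {g : (V → Fin 2) → ℝ}
    (hg : IsLipschitz G 1 g) (t : ℕ) :
    IsLipschitz G (c ^ t) (((hardcoreMRF V lam hlam).metropolis G p ^ t).mulVec g) := by
  induction t with
  | zero => simpa using hg
  | succ t ih =>
    rw [pow_succ', pow_succ', ← Matrix.mulVec_mulVec]
    exact IsLipschitz.metropolis_mulVec hlam hp0 hp1 (pow_nonneg hc0 t) hc ih

theorem sum_hardcoreWeight_pos (G : SimpleGraph V) {lam : ℝ} (hlam : 0 ≤ lam) :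
    0 < ∑ X : V → Fin 2, hardcoreWeight G lam X := by
  refine Finset.sum_pos' (fun X _ => hardcoreWeight_nonneg G hlam X) ⟨fun _ => 0, by simp, ?_⟩
  rw [hardcoreWeight, if_pos (isIndepLabeling_iff.2 (by simp))]
  simp

theorem sum_hardcoreDist (G : SimpleGraph V) {lam : ℝ} (hlam : 0 ≤ lam) :
    ∑ X : V → Fin 2, hardcoreDist G lam X = 1 := by
  simp only [hardcoreDist]
  rw [← Finset.sum_div, div_self (sum_hardcoreWeight_pos G hlam).ne']

theorem tvDistance_metropolis_pow_le {G : SimpleGraph V} [DecidableRel G.Adj]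
    {lam p c : ℝ} (hlam : 0 ≤ lam) (hp0 : 0 ≤ p) (hp1 : p ≤ 1) (hc0 : 0 ≤ c)
    (hc : ∀ X Y : V → Fin 2, IsIndepLabeling G X → IsIndepLabeling G Y →
      coupledDist G lam p X Y ≤ c * hammingDist X Y) {X : V → Fin 2} (hX : IsIndepLabeling G X)
    (t : ℕ) :
    tvDistance (((hardcoreMRF V lam hlam).metropolis G p ^ t) X) (hardcoreDist G lam) ≤
      c ^ t * Fintype.card V := by
  classical
  set P := (hardcoreMRF V lam hlam).metropolis G p
  set π := hardcoreDist G lam with hπ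
  -- The optimal test function for total variation. The values `±1/2` make its oscillation at most
  -- 1, hence it is 1-Lipschitz.
  set g : (V → Fin 2) → ℝ := fun Z => if 0 ≤ (P ^ t) X Z - π Z then 1 / 2 else -(1 / 2) with hgdef
  have hg : IsLipschitz G 1 g := by
    intro Y Z _ _
    by_cases h : Y = Z
    · subst h; simp
    · have h1 : (1 : ℝ) ≤ hammingDist Y Z := by
        exact_mod_cast Nat.one_le_iff_ne_zero.2 (hammingDist_ne_zero.2 h)
      rw [one_mul]
      refine le_trans ?_ h1
      simp only [hgdef]
      split_ifs <;> norm_num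
  have hπ0 : ∀ Y, 0 ≤ π Y := fun Y =>
    div_nonneg (hardcoreWeight_nonneg G hlam Y) (sum_hardcoreWeight_pos G hlam).le
  have hstat : ∑ Y, π Y * (P ^ t).mulVec g Y = ∑ Y, π Y * g Y := by
    have := sum_weight_mul_metropolis_pow_mulVec lam hlam G p (sum_proposal hlam p) g t
    simp only [hπ, hardcoreDist, div_mul_eq_mul_div]
    rw [← Finset.sum_div, ← Finset.sum_div, this]
  have htv : tvDistance ((P ^ t) X) π = (P ^ t).mulVec g X - ∑ Y, π Y * g Y := by
    simp only [tvDistance, Matrix.mulVec, dotProduct]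
    rw [Finset.mul_sum, ← Finset.sum_sub_distrib]
    refine Finset.sum_congr rfl fun Z _ => ?_
    simp only [hgdef]
    split_ifs with h
    · rw [abs_of_nonneg h]; ring
    · rw [abs_of_neg (not_le.1 h)]; ring
  have hmean : (P ^ t).mulVec g X = ∑ Y, π Y * (P ^ t).mulVec g X := by
    rw [← Finset.sum_mul, sum_hardcoreDist G hlam, one_mul]
  -- Stationarity turns the distance into a `π`-average of differences of `P ^ t g`, each at most `c
  -- ^ t` times the diameter bound `n`.
  rw [htv, ← hstat, hmean, ← Finset.sum_sub_distrib]
  calc ∑ Y, (π Y * (P ^ t).mulVec g X - π Y * (P ^ t).mulVec g Y)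
      ≤ ∑ Y, π Y * (c ^ t * Fintype.card V) := by
        refine Finset.sum_le_sum fun Y _ => ?_
        by_cases hY : IsIndepLabeling G Y
        · rw [← mul_sub]
          refine mul_le_mul_of_nonneg_left ?_ (hπ0 Y)
          refine (le_abs_self _).trans ((IsLipschitz.metropolis_pow_mulVec hlam hp0 hp1 hc0 hc hg t
            X Y hX hY).trans ?_)
          have : (hammingDist X Y : ℝ) ≤ Fintype.card V := by
            exact_mod_cast hammingDist_le_card_fintype
          gcongr
        · have : π Y = 0 := by simp [hπ, hardcoreDist, hardcoreWeight, hY]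
          simp [this]
    _ = c ^ t * Fintype.card V := by
        rw [← Finset.sum_mul, sum_hardcoreDist G hlam, one_mul]

end Hardcore

/-! ### Choice of constants and conclusion -/

/-- At the largest allowed fugacity the left side is `Dα/(D-1+α)`, which is nonincreasing in `D` for
`0 ≤ α < 1`; the bound is its value at `D = 2`. -/
theorem mul_fugacity_le {α lam D : ℝ} (hα : α < 1) (hlam : 0 ≤ lam) (hD : 2 ≤ D)
    (h : lam ≤ α / (D - 1)) : D * (lam / (1 + lam)) ≤ 2 * α / (1 + α) := by
  have h1 : lam * (D - 1) ≤ α := (le_div_iff₀ (by linarith)).1 h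
  have hα0 : 0 ≤ α := le_trans (by nlinarith) h1
  rw [mul_div_assoc', div_le_div_iff₀ (by linarith) (by linarith)]
  nlinarith [mul_nonneg hlam (sub_nonneg.2 hD), mul_nonneg hα0 hlam]

theorem pow_mul_le_of_log_le {ε n δ : ℝ} (hε : 0 < ε) (hε1 : ε ≤ 1) (hn : 0 < n) (hδ : 0 < δ)
    {t : ℕ} (ht : 1 / ε * Real.log (n / δ) ≤ t) : (1 - ε) ^ t * n ≤ δ := by
  have h1 : Real.log (n / δ) ≤ ε * t := by
    rw [one_div, inv_mul_le_iff₀ hε] at ht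
    exact ht
  have h2 : n / δ ≤ Real.exp (ε * t) := by
    rw [← Real.log_le_iff_le_exp (by positivity)]
    exact h1
  have h3 : (1 - ε) ^ t ≤ Real.exp (-(ε * t)) := by
    calc (1 - ε) ^ t ≤ Real.exp (-ε) ^ t :=
          pow_le_pow_left₀ (by linarith) (Real.one_sub_le_exp_neg ε) t
      _ = Real.exp (-(ε * t)) := by rw [← Real.exp_nat_mul]; ring_nf
  calc (1 - ε) ^ t * n ≤ Real.exp (-(ε * t)) * (Real.exp (ε * t) * δ) := by
        have := (div_le_iff₀ hδ).1 h2
        gcongr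
    _ = δ := by rw [← mul_assoc, ← Real.exp_add]; simp

theorem mainTheorem6 (α : ℝ) (hα : α < 1) :
    ∃ p : ℝ, 0 < p ∧ p ≤ 1 ∧ ∃ C : ℝ, 0 < C ∧
      ∀ (V : Type*) [Fintype V] [DecidableEq V] (G : SimpleGraph V) [DecidableRel G.Adj]
        (lam : ℝ) (hlam : 0 ≤ lam),
        2 ≤ G.maxDegree → lam ≤ α / ((G.maxDegree : ℝ) - 1) →
        ∀ X : V → Fin 2, IsIndepLabeling G X →
        ∀ δ : ℝ, 0 < δ →
        ∀ t : ℕ, C * Real.log ((Fintype.card V : ℝ) / δ) ≤ t →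
          tvDistance (((hardcoreMRF V lam hlam).metropolis G p ^ t) X) (hardcoreDist G lam) ≤ δ := by
  -- For negative `α` no fugacity satisfies the hypotheses.
  rcases lt_or_ge α 0 with hneg | hα0
  · refine ⟨1, one_pos, le_rfl, 1, one_pos, ?_⟩
    intro V _ _ G _ lam hlam hD hle
    have hD' : (2 : ℝ) ≤ G.maxDegree := by exact_mod_cast hD
    have := div_neg_of_neg_of_pos hneg (by linarith : (0 : ℝ) < G.maxDegree - 1)
    linarith
  set r := 2 * α / (1 + α) with hr
  have hr0 : 0 ≤ r := by positivity
  have hr1 : r < 1 := by rw [hr, div_lt_one (by linarith)]; linarith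
  -- The rate `1 - p + (1+p)pr` equals `1 - p(1 - r - pr)`. This `p` makes `pr ≤ (1-r)/2`, so at
  -- least `ε = p(1-r)/2` is gained in each transition.
  set p := (1 - r) / 2 with hp
  set ε := p * (1 - r) / 2 with hε
  have hp0 : 0 < p := by linarith
  have hp1 : p ≤ 1 := by linarith
  have hε0 : 0 < ε := by have : 0 < 1 - r := by linarith
                         positivity
  have hε1 : ε ≤ 1 := by nlinarith
  refine ⟨p, hp0, hp1, 1 / ε, by positivity, ?_⟩
  intro V _ _ G _ lam hlam hD hle X hX δ hδ t ht
  have hD' : (2 : ℝ) ≤ G.maxDegree := by exact_mod_cast hD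
  have hfug := mul_fugacity_le hα hlam hD' hle
  have hrate : 1 - p + (1 + p) * (G.maxDegree * (p * (lam / (1 + lam)))) ≤ 1 - ε := by
    have : (1 + p) * (G.maxDegree * (p * (lam / (1 + lam)))) ≤ (1 + p) * (p * r) := by
      have h2 : (G.maxDegree : ℝ) * (p * (lam / (1 + lam))) ≤ p * r := by
        calc (G.maxDegree : ℝ) * (p * (lam / (1 + lam)))
            = p * (G.maxDegree * (lam / (1 + lam))) := by ring
          _ ≤ p * r := mul_le_mul_of_nonneg_left hfug hp0.le
      gcongr
    have h3 : p * ((1 - r) * (1 - r)) / 2 ≥ 0 := by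
      have := mul_self_nonneg (1 - r)
      positivity
    have h4 : 1 - p + (1 + p) * (p * r) = 1 - ε - p * ((1 - r) * (1 - r)) / 2 := by
      rw [hε, hp]; ring
    linarith
  have hcard : (0 : ℝ) < Fintype.card V := by
    have : G.maxDegree < Fintype.card V := by
      have : Nonempty V := by
        by_contra hempty
        rw [not_nonempty_iff] at hempty
        simp at hD
      exact G.maxDegree_lt_card_verts
    exact_mod_cast (by omega : 0 < Fintype.card V)
  refine (Hardcore.tvDistance_metropolis_pow_le hlam hp0.le hp1 (sub_nonneg.2 hε1) ?_ hX t).trans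
    (pow_mul_le_of_log_le hε0 hε1 hcard hδ ht)
  intro Y Z hY hZ
  exact Hardcore.coupledDist_le hlam hp0.le hp1
    (fun W hW v hv => (Hardcore.coupledDist_update_le hlam hp0.le hp1 hW hv).trans hrate) _
    Y Z hY hZ rfl
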